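/- For every integer $n \ge 1$ and every HKZ-reduced basis $b_1,\dots,b_n$ of a lattice of rank $n$ in a Euclidean space $\mathbb{R}^m$, the orthogonality defect satisfies $$\frac{\prod_{i=1}^n \|b_i\|}{\det \mathcal{L}(b_1,\dots,b_n)} \;\le\; 2^{\,n\log_2 n-\left(\frac52+\frac12\log_2 e\right)n+O(\log n)},$$ where the error term depends only on $n$; that is, there is one function $f:\mathbb{N}\to\mathbb{R}$ with $f(n)=O(\log n)$ as $n\to\infty$, such that the bound with $f(n)$ in place of $O(\log n)$ holds for all $n \ge 1$, all $m$ and all such bases. Here $\mathcal{L}(b_1,\dots,b_n)=\{\sum_i x_i b_i : x_i\in\mathbb{Z}\}$ for linearly independent $b_1,\dots,b_n$, and $\det\mathcal{L}(b_1,\dots,b_n)=\sqrt{\det(\langle b_i,b_j\rangle)_{i,j}}$. HKZ-reducedness is defined by induction on the rank: every basis of rank $1$ is HKZ-reduced, and a basis $b_1,\dots,b_k$ with $k\ge2$ is HKZ-reduced if (i) $b_1$ is a shortest nonzero vector of $\mathcal{L}(b_1,\dots,b_k)$; (ii) the orthogonal projections of $b_2,\dots,b_k$ onto $b_1^\perp$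 form an HKZ-reduced basis; (iii) $|\langle b_1,b_i\rangle|\le\frac12|\langle b_1,b_1\rangle|$ for $i=2,\dots,k$. -/

import Mathlib

open scoped InnerProductSpace

noncomputable section

/-- The lattice `ℒ(b₁, …, bₙ) = ℤ b₁ + ⋯ + ℤ bₙ` generated by a family of vectors. -/
def latticeOf {E : Type*} [NormedAddCommGroup E] {n : ℕ} (b : Fin n → E) : Submodule ℤ E :=
  Submodule.span ℤ (Set.range b)

/-- `v` is a shortest vector of the lattice `L`: a nonzero element of `L` of least norm. -/
def IsShortestVector {E : Type*} [NormedAddCommGroup E] (L : Submodule ℤ E) (v : E) : Prop :=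
  v ∈ L ∧ v ≠ 0 ∧ ∀ w ∈ L, w ≠ 0 → ‖v‖ ≤ ‖w‖

/-- The determinant (volume) `√(det (B Bᵀ))` of the lattice with basis `b`, where `B Bᵀ` is the
matrix of the inner products `⟪bᵢ, bⱼ⟫`. -/
def latticeDet {E : Type*} [NormedAddCommGroup E] [InnerProductSpace ℝ E] {n : ℕ}
    (b : Fin n → E) : ℝ :=
  Real.sqrt (Matrix.gram ℝ b).det

/-- The orthogonality defect `(‖b₁‖ ⋯ ‖bₙ‖) / det ℒ(b₁, …, bₙ)` of a lattice basis. -/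
def orthogonalityDefect {E : Type*} [NormedAddCommGroup E] [InnerProductSpace ℝ E] {n : ℕ}
    (b : Fin n → E) : ℝ :=
  (∏ i, ‖b i‖) / latticeDet b

/-- HKZ-reduction (Hermite–Korkine–Zolotarev) of a lattice basis, by induction on the rank.
A basis of rank one is always HKZ-reduced. A basis `b₁, …, bₖ` with `k ≥ 2` is HKZ-reduced if
`b₁` is a shortest vector of the lattice, if the projections of `b₂, …, bₖ` to the orthogonal
complement of `b₁` form an HKZ-reduced basis, and if `|⟪b₁, bᵢ⟫| ≤ |⟪b₁, b₁⟫| / 2` for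
`i = 2, …, k`. -/
def IsHKZReduced {E : Type*} [NormedAddCommGroup E] [InnerProductSpace ℝ E] :
    {n : ℕ} → (Fin n → E) → Prop
  | 0, _ => True
  | 1, _ => True
  | n + 2, b =>
    IsShortestVector (latticeOf b) (b 0) ∧
    IsHKZReduced (fun i : Fin (n + 1) => (ℝ ∙ b 0)ᗮ.starProjection (b i.succ)) ∧
    ∀ i : Fin (n + 1), |⟪b 0, b i.succ⟫_ℝ| ≤ 1 / 2 * |⟪b 0, b 0⟫_ℝ|

end

/-!
The proof compares two products with the product of the Gram–Schmidt lengths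
`rᵢ = ‖bᵢ*‖`, which is the determinant of the lattice (`IsHKZFactor.latticeDet_eq`). Let
`Mₖ = max_{j ≤ k} rⱼ`.

Size reduction gives `‖bᵢ‖² ≤ rᵢ² + ¼ ∑_{j < i} rⱼ² ≤ (i + 4) / 4 · Mᵢ²`, counting `i` from `0`
(`IsHKZFactor.norm_sq_le`), so that `∏ ‖bᵢ‖ ≤ 2⁻ⁿ √((n + 3)! / 6) ∏ Mᵢ`.

It remains to bound `∏ Mᵢ / ∏ rᵢ` (`IsHKZFactor.prod_le`). Scale the lattice by `1 / Mₗ` along the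
`l`-th Gram–Schmidt direction. The scaled lattice has determinant `∏ rᵢ / ∏ Mᵢ`, and its nonzero
vectors have length at least `1`: in an HKZ-reduced basis `rⱼ` is the minimum of the lattice
projected orthogonally to `b₀, …, bⱼ₋₁`, and this is applied at the index `j` where the running
maximum is attained. The running maxima thus play the part that successive minima play in
Minkowski's second theorem.

A lattice of minimum `1` cannot have small determinant. Minkowski's convex body theorem would lose
an exponential factor here, and Blichfeldt's bound is needed (`volume_ball_le_mul_abs_det`): points
at mutual distance at least `1` in a ball of radius `ρ`, `ρ² = (1 - ε) / 2`, number at most `1 / ε`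
(`card_mul_le_one_of_separated`), so the volume of that ball is at most `1 / ε` times the
determinant. With Stirling's bounds, `∏ Mᵢ / ∏ rᵢ = O((n / (π e (1 - ε)²)) ^ (n / 2))`.
As `π e > 8`, a fixed `ε` leaves `O((n / 8) ^ (n / 2))`, which is what the constant `5 / 2` asks for.
-/

/-! ### HKZ-reduced bases in Gram–Schmidt coordinates -/

open Finset in
/-- `T` is the matrix of the family `b` in the orthonormal frame of its Gram–Schmidt vectors, and
`b` is HKZ-reduced, in coordinates: `short` says that `T j j = ‖bⱼ*‖` is the length of a shortest
nonzero vector of the lattice projected orthogonally to `b₀, …, bⱼ₋₁`, the projection being the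
deletion of the columns `l < j`. -/
structure IsHKZFactor {E : Type*} [NormedAddCommGroup E] [InnerProductSpace ℝ E] {n : ℕ}
    (b : Fin n → E) (T : Matrix (Fin n) (Fin n) ℝ) : Prop where
  lower : ∀ i j, i < j → T i j = 0
  diag_pos : ∀ i, 0 < T i i
  size : ∀ i j, j < i → |T i j| ≤ T j j / 2
  inner_eq : ∀ i j, ⟪b i, b j⟫_ℝ = ∑ l, T i l * T j l
  short : ∀ (x : Fin n → ℤ) (j k : Fin n), j ≤ k → x k ≠ 0 →
    T j j ^ 2 ≤ ∑ l ∈ Ici j, (∑ i, (x i : ℝ) * T i l) ^ 2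

section
variable {E : Type*} [NormedAddCommGroup E] [InnerProductSpace ℝ E]

theorem starProjection_orthogonal_singleton (u v : E) :
    (ℝ ∙ u)ᗮ.starProjection v = v - (⟪u, v⟫_ℝ / ‖u‖ ^ 2) • u := by
  rw [Submodule.starProjection_orthogonal_val, Submodule.starProjection_singleton]
  simp

theorem linearIndependent_starProjection_orthogonal {n : ℕ} {b : Fin (n + 1) → E}
    (hb : LinearIndependent ℝ b) :
    LinearIndependent ℝ (fun i : Fin n => (ℝ ∙ b 0)ᗮ.starProjection (b i.succ)) := by
  rw [Fintype.linearIndependent_iff] at hb ⊢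
  intro c hc i
  have := hb (Fin.cons (-∑ i, c i * (⟪b 0, b i.succ⟫_ℝ / ‖b 0‖ ^ 2)) c) ?_ i.succ
  · simpa using this
  · rw [Fin.sum_univ_succ]
    simp only [starProjection_orthogonal_singleton, smul_sub, smul_smul, Finset.sum_sub_distrib,
      ← Finset.sum_smul] at hc
    simp only [Fin.cons_zero, Fin.cons_succ, neg_smul]
    rw [← hc]
    abel

/-- The inner product splits into the part along `u` and the part orthogonal to `u`. -/
theorem inner_eq_add_inner_starProjection {u : E} (hu : u ≠ 0) (v w : E) :
    ⟪v, w⟫_ℝ = ⟪u, v⟫_ℝ / ‖u‖ * (⟪u, w⟫_ℝ / ‖u‖) +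
      ⟪(ℝ ∙ u)ᗮ.starProjection v, (ℝ ∙ u)ᗮ.starProjection w⟫_ℝ := by
  have hu' : ‖u‖ ≠ 0 := norm_ne_zero_iff.mpr hu
  simp only [starProjection_orthogonal_singleton, inner_sub_left, inner_sub_right, inner_smul_left,
    inner_smul_right, real_inner_self_eq_norm_sq, real_inner_comm u v]
  simp
  field_simp
  ring

theorem norm_sq_sum_of_inner_eq {n : ℕ} {b : Fin n → E} {T : Matrix (Fin n) (Fin n) ℝ}
    (h : ∀ i j, ⟪b i, b j⟫_ℝ = ∑ l, T i l * T j l) (x : Fin n → ℝ) :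
    ‖∑ i, x i • b i‖ ^ 2 = ∑ l, (∑ i, x i * T i l) ^ 2 := by
  have h1 : ∀ l, (∑ i, x i * T i l) ^ 2 = ∑ i, ∑ j, x i * T i l * (x j * T j l) := fun l => by
    rw [sq, Finset.sum_mul_sum]
  rw [← real_inner_self_eq_norm_sq, sum_inner]
  simp only [inner_sum, inner_smul_left, inner_smul_right, h, h1, conj_trivial, Finset.mul_sum]
  symm
  rw [Finset.sum_comm]
  refine Finset.sum_congr rfl fun i _ => ?_
  rw [Finset.sum_comm]
  exact Finset.sum_congr rfl fun j _ => Finset.sum_congr rfl fun l _ => by ring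

/-- Prepending a shortest vector: the first column of the new factor holds the coordinates along
`b 0`, and the remaining block is the factor of the projected family. -/
theorem IsHKZFactor.exists_of_starProjection {n : ℕ} {b : Fin (n + 1) → E} (h0 : b 0 ≠ 0)
    (hshort : ∀ x : Fin (n + 1) → ℤ, x ≠ 0 → ‖b 0‖ ≤ ‖∑ i, (x i : ℝ) • b i‖)
    (hsize : ∀ i : Fin n, |⟪b 0, b i.succ⟫_ℝ| ≤ 1 / 2 * |⟪b 0, b 0⟫_ℝ|)
    {T' : Matrix (Fin n) (Fin n) ℝ}
    (hT' : IsHKZFactor (fun i : Fin n => (ℝ ∙ b 0)ᗮ.starProjection (b i.succ)) T') :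
    ∃ T, IsHKZFactor b T := by
  have hpos : 0 < ‖b 0‖ := norm_pos_iff.mpr h0
  let T : Matrix (Fin (n + 1)) (Fin (n + 1)) ℝ := fun i =>
    Fin.cons (⟪b 0, b i⟫_ℝ / ‖b 0‖) (Fin.cases (fun _ => 0) (fun i' => T' i') i)
  have T_zero : ∀ i, T i 0 = ⟪b 0, b i⟫_ℝ / ‖b 0‖ := fun i => rfl
  have T_zero_succ : ∀ l : Fin n, T 0 l.succ = 0 := fun l => rfl
  have T_succ : ∀ i l : Fin n, T i.succ l.succ = T' i l := fun i l => rfl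
  have T00 : T 0 0 = ‖b 0‖ := by
    rw [T_zero, real_inner_self_eq_norm_sq]; field_simp
  have proj0 : (ℝ ∙ b 0)ᗮ.starProjection (b 0) = 0 := by
    rw [starProjection_orthogonal_singleton, real_inner_self_eq_norm_sq, div_self (by positivity)]
    simp
  have hinner : ∀ i j, ⟪b i, b j⟫_ℝ = ∑ l, T i l * T j l := by
    intro i j
    rw [inner_eq_add_inner_starProjection h0, Fin.sum_univ_succ, T_zero, T_zero]
    congr 1
    cases i using Fin.cases with
    | zero => simp [proj0, T_zero_succ]
    | succ i =>
      cases j using Fin.cases with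
      | zero => simp [proj0, T_zero_succ]
      | succ j => simpa only [T_succ] using hT'.inner_eq i j
  refine ⟨T, ?_, ?_, ?_, hinner, ?_⟩
  · intro i j hij
    cases j using Fin.cases with
    | zero => simp at hij
    | succ j =>
      cases i using Fin.cases with
      | zero => exact T_zero_succ j
      | succ i => rw [T_succ]; exact hT'.lower i j (by simpa using hij)
  · intro i
    cases i using Fin.cases with
    | zero => rw [T00]; exact hpos
    | succ i => rw [T_succ]; exact hT'.diag_pos i
  · intro i j hij
    cases i using Fin.cases with
    | zero => simp at hij
    | succ i =>
      cases j using Fin.cases with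
      | zero =>
        have := hsize i
        rw [real_inner_self_eq_norm_sq, abs_of_nonneg (sq_nonneg ‖b 0‖)] at this
        rw [T00, T_zero, abs_div, abs_of_pos hpos, div_le_iff₀ hpos]
        linarith
      | succ j => rw [T_succ, T_succ]; exact hT'.size i j (by simpa using hij)
  · intro x j k hjk hxk
    cases j using Fin.cases with
    | zero =>
      have hI : Finset.Ici (0 : Fin (n + 1)) = Finset.univ := by ext; simp
      rw [hI, ← norm_sq_sum_of_inner_eq hinner, T00]
      exact pow_le_pow_left₀ hpos.le (hshort x fun h => hxk (by simp [h])) 2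
    | succ j =>
      cases k using Fin.cases with
      | zero => simp at hjk
      | succ k =>
        have := hT'.short (fun i => x i.succ) j k (by simpa using hjk) hxk
        rw [T_succ, ← Fin.map_succEmb_Ici, Finset.sum_map]
        simpa [Fin.sum_univ_succ, T_zero_succ, T_succ] using this

/-- In rank one the definition of HKZ-reduction says nothing, and linear independence supplies what
the inductive step needs. -/
theorem IsHKZReduced.exists_isHKZFactor : ∀ {n : ℕ} {b : Fin n → E}, LinearIndependent ℝ b →
    IsHKZReduced b → ∃ T, IsHKZFactor b T
  | 0, _, _, _ => ⟨0, ⟨fun i => i.elim0, fun i => i.elim0, fun i => i.elim0, fun i => i.elim0,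
      fun _ i => i.elim0⟩⟩
  | 1, b, hb, _ => by
    obtain ⟨T', hT'⟩ := IsHKZReduced.exists_isHKZFactor
      (b := fun i : Fin 0 => (ℝ ∙ b 0)ᗮ.starProjection (b i.succ))
      (linearIndependent_starProjection_orthogonal hb) trivial
    refine IsHKZFactor.exists_of_starProjection (hb.ne_zero 0) (fun x hx => ?_)
      (fun i => i.elim0) hT'
    have hx0 : x 0 ≠ 0 := fun h => hx (by ext i; rw [Fin.fin_one_eq_zero i, h]; rfl)
    have h1 : (1 : ℝ) ≤ |(x 0 : ℝ)| := by exact_mod_cast Int.one_le_abs hx0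
    rw [Fin.sum_univ_one, norm_smul, Real.norm_eq_abs]
    exact le_mul_of_one_le_left (norm_nonneg _) h1
  | n + 2, b, hb, h => by
    obtain ⟨⟨-, -, hmin⟩, hproj, hsize⟩ := h
    obtain ⟨T', hT'⟩ := IsHKZReduced.exists_isHKZFactor
      (linearIndependent_starProjection_orthogonal hb) hproj
    refine IsHKZFactor.exists_of_starProjection (hb.ne_zero 0) (fun x hx => ?_) hsize hT'
    refine hmin _ (Submodule.sum_mem _ fun i _ => ?_) fun h0 => hx ?_
    · rw [Int.cast_smul_eq_zsmul]
      exact Submodule.smul_mem _ _ (Submodule.subset_span ⟨i, rfl⟩)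
    · ext i
      exact_mod_cast Fintype.linearIndependent_iff.mp hb _ h0 i

theorem IsHKZFactor.latticeDet_eq {n : ℕ} {b : Fin n → E} {T : Matrix (Fin n) (Fin n) ℝ}
    (h : IsHKZFactor b T) : latticeDet b = ∏ i, T i i := by
  have hg : Matrix.gram ℝ b = T * T.transpose := by
    ext i j
    rw [Matrix.gram_apply, h.inner_eq, Matrix.mul_apply]
    rfl
  rw [latticeDet, hg, Matrix.det_mul, Matrix.det_transpose,
    Matrix.det_of_isLowerTriangular T fun i j hij => h.lower i j hij]
  exact Real.sqrt_mul_self (Finset.prod_nonneg fun i _ => (h.diag_pos i).le)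

open Finset in
/-- Size reduction bounds `‖bᵢ‖` by the Gram–Schmidt lengths up to index `i`. -/
theorem IsHKZFactor.norm_sq_le {n : ℕ} {b : Fin n → E} {T : Matrix (Fin n) (Fin n) ℝ}
    (h : IsHKZFactor b T) {M : ℝ} (i : Fin n) (hM : ∀ j ≤ i, T j j ≤ M) :
    ‖b i‖ ^ 2 ≤ ((i : ℝ) + 4) / 4 * M ^ 2 := by
  have h1 : ‖b i‖ ^ 2 = ∑ l ∈ Iic i, T i l ^ 2 := by
    rw [← real_inner_self_eq_norm_sq, h.inner_eq]
    symm
    rw [sum_subset (subset_univ (Iic i))]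
    · exact sum_congr rfl fun l _ => by ring
    · intro l _ hl
      rw [h.lower i l (by simpa using hl)]
      ring
  have h2 : ∑ l ∈ Iio i, T i l ^ 2 ≤ ∑ l ∈ Iio i, M ^ 2 / 4 := by
    refine sum_le_sum fun l hl => ?_
    have hl' : l < i := mem_Iio.mp hl
    have h3 : |T i l| ≤ M / 2 := (h.size i l hl').trans (by linarith [hM l hl'.le])
    rw [← sq_abs]
    calc |T i l| ^ 2 ≤ (M / 2) ^ 2 := pow_le_pow_left₀ (abs_nonneg _) h3 2
      _ = M ^ 2 / 4 := by ring
  have h4 : T i i ^ 2 ≤ M ^ 2 := pow_le_pow_left₀ (h.diag_pos i).le (hM i le_rfl) 2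
  rw [h1, ← Iio_insert, sum_insert (by simp)]
  rw [sum_const, Fin.card_Iio, nsmul_eq_mul] at h2
  linarith
end

/-! ### Blichfeldt's bound -/

open MeasureTheory Finset in
/-- Points at mutual distance at least `1`, all within distance `ρ` of the origin with
`ρ² = (1 - ε) / 2`: since `∑ᵢⱼ ‖vᵢ - vⱼ‖² ≤ 2 m ∑ᵢ ‖vᵢ‖²`, their number
`m` is at most `1 / ε`. -/
theorem card_mul_le_one_of_separated {E : Type*} [NormedAddCommGroup E] [InnerProductSpace ℝ E]
    (s : Finset E) {ε : ℝ}
    (hsep : ∀ v ∈ s, ∀ w ∈ s, v ≠ w → 1 ≤ ‖v - w‖) (hρ : ∀ v ∈ s, ‖v‖ ^ 2 ≤ (1 - ε) / 2) :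
    (#s : ℝ) * ε ≤ 1 := by
  classical
  rcases s.eq_empty_or_nonempty with rfl | hs
  · simp
  have hm : 0 < (#s : ℝ) := by exact_mod_cast hs.card_pos
  have hid : ∑ v ∈ s, ∑ w ∈ s, ‖v - w‖ ^ 2 =
      2 * #s * ∑ v ∈ s, ‖v‖ ^ 2 - 2 * ‖∑ v ∈ s, v‖ ^ 2 := by
    rw [← real_inner_self_eq_norm_sq (∑ v ∈ s, v), sum_inner]
    simp only [norm_sub_sq_real, sum_add_distrib, sum_sub_distrib, sum_const, nsmul_eq_mul,
      ← mul_sum, inner_sum]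
    ring
  have hlow : (#s : ℝ) * (#s - 1) ≤ ∑ v ∈ s, ∑ w ∈ s, ‖v - w‖ ^ 2 := by
    have : ∀ v ∈ s, (#s : ℝ) - 1 ≤ ∑ w ∈ s, ‖v - w‖ ^ 2 := by
      intro v hv
      calc (#s : ℝ) - 1 = ∑ w ∈ s.erase v, (1 : ℝ) := by
            rw [sum_const, nsmul_eq_mul, mul_one, card_erase_of_mem hv,
              Nat.cast_sub hs.card_pos, Nat.cast_one]
        _ ≤ ∑ w ∈ s.erase v, ‖v - w‖ ^ 2 := by
            refine sum_le_sum fun w hw => ?_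
            exact one_le_pow₀ (hsep v hv w (mem_of_mem_erase hw) (ne_of_mem_erase hw).symm)
        _ ≤ _ := sum_le_sum_of_subset_of_nonneg (erase_subset _ _) fun _ _ _ => sq_nonneg _
    calc (#s : ℝ) * (#s - 1) = ∑ v ∈ s, ((#s : ℝ) - 1) := by rw [sum_const, nsmul_eq_mul]
      _ ≤ _ := sum_le_sum this
  have hup : ∑ v ∈ s, ‖v‖ ^ 2 ≤ #s * ((1 - ε) / 2) := by
    simpa [sum_const, nsmul_eq_mul] using sum_le_sum hρ
  have h1 : (#s : ℝ) * (#s - 1) ≤ #s * (#s * (1 - ε)) := by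
    nlinarith [sq_nonneg ‖∑ v ∈ s, v‖, mul_le_mul_of_nonneg_left hup hm.le]
  have h2 := le_of_mul_le_mul_left h1 hm
  linarith

open MeasureTheory in
/-- A set that meets every orbit in at most `C` points has measure at most `C` times that of a
fundamental domain. -/
theorem MeasureTheory.IsAddFundamentalDomain.measure_le_mul {G α : Type*} [AddGroup G]
    [AddAction G α] [MeasurableSpace α] [MeasurableSpace G] [MeasurableConstVAdd G α]
    [Countable G] {F : Set α} {μ : Measure α} [VAddInvariantMeasure G α μ]
    (hF : IsAddFundamentalDomain G F μ) {S : Set α} (hS : MeasurableSet S) {C : ENNReal}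
    (hC : ∀ (x : α) (t : Finset G), (∀ g ∈ t, g +ᵥ x ∈ S) → (t.card : ENNReal) ≤ C) :
    μ S ≤ C * μ F := by
  classical
  rw [← lintegral_indicator_one hS, hF.lintegral_eq_tsum'', ← lintegral_tsum]
  · rw [← setLIntegral_const]
    refine lintegral_mono fun x => ?_
    rw [ENNReal.tsum_eq_iSup_sum]
    refine iSup_le fun t => ?_
    refine le_trans (le_of_eq ?_) (hC x (t.filter fun g => g +ᵥ x ∈ S) (by simp))
    rw [Finset.card_filter, Nat.cast_sum]
    refine Finset.sum_congr rfl fun g _ => ?_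
    by_cases h : g +ᵥ x ∈ S <;> simp [h]
  · intro g
    exact ((measurable_one.indicator hS).comp (measurable_const_vadd g)).aemeasurable

open MeasureTheory in
/-- Blichfeldt's bound for lattices of minimum at least `1`, spanned by the rows of `A`: balls of
radius `ρ`, with `ρ² = (1 - ε) / 2`, contain at most `1 / ε` points of a translate. -/
theorem volume_ball_le_mul_abs_det {n : ℕ} (hn : 1 ≤ n) (A : Matrix (Fin n) (Fin n) ℝ)
    (hA : A.det ≠ 0) {ε : ℝ} (hε : 0 < ε)
    (hmin : ∀ x : Fin n → ℤ, x ≠ 0 → 1 ≤ ∑ l, (∑ i, (x i : ℝ) * A i l) ^ 2) :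
    √((1 - ε) / 2) ^ n * (√Real.pi ^ n / Real.Gamma ((n : ℝ) / 2 + 1)) ≤ 1 / ε * |A.det| := by
  let e := (EuclideanSpace.basisFun (Fin n) ℝ).toBasis
  let a : Fin n → EuclideanSpace ℝ (Fin n) := fun i => WithLp.toLp 2 (A i)
  have hdet : e.det a = A.det := by
    rw [Module.Basis.det_apply, ← Matrix.det_transpose]
    congr 1
  have hbasis := (Module.Basis.is_basis_iff_det (e := e) (v := a)).mpr (by rw [hdet]; exact hA.isUnit)
  let B := Module.Basis.mk hbasis.1 hbasis.2.ge
  have hBa : ∀ i, B i = a i := fun i => Module.Basis.mk_apply _ _ i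
  have hBa' : (B : Fin n → _) = a := funext hBa
  have hvol : volume (ZSpan.fundamentalDomain B) = ENNReal.ofReal |A.det| := by
    rw [ZSpan.measure_fundamentalDomain B volume e, hBa', hdet,
      measure_congr (ZSpan.fundamentalDomain_ae_parallelepiped e volume)]
    simp [e, OrthonormalBasis.volume_parallelepiped]
  have hlat : ∀ v ∈ Submodule.span ℤ (Set.range B), v ≠ 0 → 1 ≤ ‖v‖ := by
    intro v hv hv0
    obtain ⟨x, rfl⟩ := (Submodule.mem_span_range_iff_exists_fun ℤ).mp hv
    have hx : x ≠ 0 := by rintro rfl; simp at hv0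
    rw [← one_le_sq_iff₀ (norm_nonneg _), EuclideanSpace.norm_sq_eq]
    refine (hmin x hx).trans_eq (Finset.sum_congr rfl fun l _ => ?_)
    rw [Real.norm_eq_abs, sq_abs]
    simp [hBa, a]
  have hF := ZSpan.isAddFundamentalDomain B (volume : Measure (EuclideanSpace ℝ (Fin n)))
  have : VAddInvariantMeasure (Submodule.span ℤ (Set.range B)) (EuclideanSpace ℝ (Fin n)) volume :=
    inferInstanceAs <| VAddInvariantMeasure (Submodule.span ℤ (Set.range B)).toAddSubgroup _ volume
  have key := hF.measure_le_mul (S := Metric.ball 0 (√((1 - ε) / 2))) measurableSet_ball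
    (C := ENNReal.ofReal (1 / ε)) ?_
  · have : Nonempty (Fin n) := ⟨⟨0, hn⟩⟩
    rw [hvol, EuclideanSpace.volume_ball, Fintype.card_fin,
      ← ENNReal.ofReal_pow (Real.sqrt_nonneg _), ← ENNReal.ofReal_mul (by positivity),
      ← ENNReal.ofReal_mul (by positivity), ENNReal.ofReal_le_ofReal_iff (by positivity)] at key
    exact key
  · intro x t ht
    rw [← ENNReal.ofReal_natCast]
    refine ENNReal.ofReal_le_ofReal ?_
    rw [le_div_iff₀ hε]
    have hinj : Function.Injective fun g : Submodule.span ℤ (Set.range B) =>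
        (g : EuclideanSpace ℝ (Fin n)) + x := fun g g' h => Subtype.ext (add_right_cancel h)
    rw [← Finset.card_map ⟨_, hinj⟩]
    refine card_mul_le_one_of_separated _ ?_ ?_
    · intro v hv w hw hvw
      obtain ⟨g, -, rfl⟩ := Finset.mem_map.mp hv
      obtain ⟨g', -, rfl⟩ := Finset.mem_map.mp hw
      have := hlat (g - g') (Submodule.sub_mem _ g.2 g'.2)
        (fun h => hvw (by simp [sub_eq_zero.mp h]))
      simpa using this
    · intro v hv
      obtain ⟨g, hg, rfl⟩ := Finset.mem_map.mp hv
      have := ht g hg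
      rw [mem_ball_zero_iff, Real.lt_sqrt (norm_nonneg _)] at this
      exact this.le

/-! ### Upper bounds for the Gamma function and the factorial -/

/-- An upper bound of Stirling type with a free parameter: of the weight `e⁻ᵗ`, the part
`e^{-(1-ε)t}` is traded against `tˢ`, and the rest is integrated. -/
theorem Real.Gamma_add_one_le {s ε : ℝ} (hs : 0 < s) (hε : 0 < ε) (hε1 : ε < 1) :
    Real.Gamma (s + 1) ≤ (s / ((1 - ε) * Real.exp 1)) ^ s * (1 / ε) := by
  have hc : 0 < 1 - ε := by linarith
  have hpt : ∀ t ∈ Set.Ioi (0 : ℝ), Real.exp (-t) * t ^ (s + 1 - 1) ≤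
      (s / ((1 - ε) * Real.exp 1)) ^ s * Real.exp (-ε * t) := by
    intro t ht
    have ht : 0 < t := ht
    have h1 : (1 - ε) * t / s ≤ Real.exp ((1 - ε) * t / s - 1) := by
      linarith [Real.add_one_le_exp ((1 - ε) * t / s - 1)]
    have h2 : t ≤ s / ((1 - ε) * Real.exp 1) * Real.exp ((1 - ε) * t / s) := by
      rw [Real.exp_sub, le_div_iff₀ (Real.exp_pos 1)] at h1
      rw [div_mul_eq_mul_div, le_div_iff₀ (by positivity)]
      calc t * ((1 - ε) * Real.exp 1) = s * ((1 - ε) * t / s * Real.exp 1) := by field_simp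
        _ ≤ _ := mul_le_mul_of_nonneg_left h1 hs.le
    have h3 := Real.rpow_le_rpow ht.le h2 hs.le
    rw [Real.mul_rpow (by positivity) (by positivity), ← Real.exp_mul,
      div_mul_cancel₀ _ hs.ne'] at h3
    rw [add_sub_cancel_right]
    calc Real.exp (-t) * t ^ s ≤ Real.exp (-t) *
        ((s / ((1 - ε) * Real.exp 1)) ^ s * Real.exp ((1 - ε) * t)) :=
          mul_le_mul_of_nonneg_left h3 (Real.exp_pos _).le
      _ = (s / ((1 - ε) * Real.exp 1)) ^ s * (Real.exp (-t) * Real.exp ((1 - ε) * t)) := by ring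
      _ = _ := by rw [← Real.exp_add]; congr 2; ring
  rw [Real.Gamma_eq_integral (by linarith)]
  refine (MeasureTheory.setIntegral_mono_on (Real.GammaIntegral_convergent (by linarith)) ?_
    measurableSet_Ioi hpt).trans (le_of_eq ?_)
  · exact (integrableOn_exp_mul_Ioi (by linarith) 0).const_mul _
  · rw [MeasureTheory.integral_const_mul, integral_exp_mul_Ioi (by linarith)]
    simp

theorem Nat.factorial_le_stirling (n : ℕ) (hn : 1 ≤ n) :
    (n.factorial : ℝ) ≤ Real.exp 1 * n * (n / Real.exp 1) ^ n := by
  have h := Stirling.stirlingSeq'_antitone (Nat.zero_le (n - 1))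
  simp only [Function.comp_apply, Nat.succ_eq_add_one, Nat.sub_add_cancel hn, zero_add,
    Stirling.stirlingSeq_one] at h
  have hn' : (1 : ℝ) ≤ n := by exact_mod_cast hn
  rw [Stirling.stirlingSeq, div_le_iff₀ (by positivity), ← mul_assoc] at h
  refine h.trans ?_
  refine mul_le_mul_of_nonneg_right ?_ (by positivity)
  rw [div_mul_eq_mul_div, Real.sqrt_mul (by norm_num), ← mul_assoc, div_le_iff₀ (by positivity)]
  have : √(n : ℝ) ≤ n := by
    rw [Real.sqrt_le_left (by positivity)]; nlinarith
  have h5 := mul_le_mul_of_nonneg_left this (by positivity : 0 ≤ Real.exp 1 * √2)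
  linarith

/-! ### The orthogonality defect -/

/-- The lattice spanned by the rows of `A`, of minimum at least `1`, has covolume at least
`(9 / 10000) (8 / n) ^ (n / 2)`. The loss `ε = 3 / 100` in the radius and in the Gamma function is
affordable since `(1 - ε)² π e > 8`. -/
theorem one_le_mul_abs_det {n : ℕ} (hn : 1 ≤ n) (A : Matrix (Fin n) (Fin n) ℝ) (hA : A.det ≠ 0)
    (hmin : ∀ x : Fin n → ℤ, x ≠ 0 → 1 ≤ ∑ l, (∑ i, (x i : ℝ) * A i l) ^ 2) :
    1 ≤ 10000 / 9 * √((n : ℝ) / 8) ^ n * |A.det| := by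
  have hn' : (0 : ℝ) < n := by exact_mod_cast hn
  have h1 := volume_ball_le_mul_abs_det hn A hA (ε := 3 / 100) (by norm_num) hmin
  have h2 := Real.Gamma_add_one_le (s := (n : ℝ) / 2) (ε := 3 / 100) (by positivity)
    (by norm_num) (by norm_num)
  have hG : 0 < Real.Gamma ((n : ℝ) / 2 + 1) := Real.Gamma_pos_of_pos (by positivity)
  rw [Real.rpow_div_two_eq_sqrt _ (by have := Real.exp_pos 1; positivity), Real.rpow_natCast] at h2
  rw [← mul_div_assoc, ← mul_pow, div_le_iff₀ hG] at h1
  set c := √((1 - 3 / 100 : ℝ) / 2) * √Real.pi with hc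
  set q := √((n : ℝ) / 2 / ((1 - 3 / 100) * Real.exp 1)) with hq
  have hc0 : 0 < c := by have := Real.pi_pos; rw [hc]; norm_num; positivity
  have hqc : q ≤ √((n : ℝ) / 8) * c := by
    rw [hq, hc, ← Real.sqrt_mul (by norm_num), ← Real.sqrt_mul (by positivity)]
    refine Real.sqrt_le_sqrt ?_
    have he := Real.exp_one_gt_d9
    have hp := Real.pi_gt_d4
    rw [div_le_iff₀ (by positivity)]
    have : 8.53 ≤ Real.pi * Real.exp 1 := by nlinarith
    nlinarith [mul_le_mul_of_nonneg_left this hn'.le]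
  have hD : 0 ≤ |A.det| := abs_nonneg _
  have h3 : c ^ n ≤ 10000 / 9 * √((n : ℝ) / 8) ^ n * |A.det| * c ^ n := by
    calc c ^ n ≤ 1 / (3 / 100) * |A.det| * Real.Gamma ((n : ℝ) / 2 + 1) := h1
      _ ≤ 1 / (3 / 100) * |A.det| * ((√((n : ℝ) / 8) * c) ^ n * (1 / (3 / 100))) := by
          gcongr
          exact h2.trans (by gcongr)
      _ = _ := by rw [mul_pow]; ring
  exact le_of_mul_le_mul_right (by simpa using h3) (pow_pos hc0 n)

section
variable {E : Type*} [NormedAddCommGroup E] [InnerProductSpace ℝ E]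

open Finset in
/-- Divide the `l`-th coordinate by the running maximum `M l` of the Gram–Schmidt lengths. The
resulting lattice has minimum at least `1`: a lattice vector with last nonzero coefficient at `k`
projects to length at least `M k` orthogonally to `b₀, …, bⱼ₋₁`, if `j ≤ k` is where the maximum
`M k` is attained. -/
theorem IsHKZFactor.prod_le {n : ℕ} (hn : 1 ≤ n) {b : Fin n → E} {T : Matrix (Fin n) (Fin n) ℝ}
    (h : IsHKZFactor b T) {M : Fin n → ℝ} (hmono : Monotone M) (hM : ∀ i, T i i ≤ M i)
    (hatt : ∀ k, ∃ j ≤ k, T j j = M k) :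
    ∏ i, M i ≤ 10000 / 9 * √((n : ℝ) / 8) ^ n * ∏ i, T i i := by
  have hMpos : ∀ i, 0 < M i := fun i => (h.diag_pos i).trans_le (hM i)
  let A : Matrix (Fin n) (Fin n) ℝ := fun i l => T i l / M l
  have hdet : A.det = (∏ i, T i i) / ∏ i, M i := by
    rw [Matrix.det_of_isLowerTriangular A, ← prod_div_distrib]
    intro i j hij
    change T i j / M j = 0
    rw [h.lower i j hij, zero_div]
  have hT : 0 < ∏ i, T i i := prod_pos fun i _ => h.diag_pos i
  have hP : 0 < ∏ i, M i := prod_pos fun i _ => hMpos i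
  have hA : 0 < A.det := by rw [hdet]; positivity
  have key := one_le_mul_abs_det hn A hA.ne' ?_
  · rw [abs_of_pos hA, hdet, ← mul_div_assoc, le_div_iff₀ hP, one_mul] at key
    exact key
  · intro x hx
    obtain ⟨k, hk, hkmax⟩ : ∃ k, x k ≠ 0 ∧ ∀ i, k < i → x i = 0 := by
      obtain ⟨i, hi⟩ := Function.ne_iff.mp hx
      have hne : (univ.filter fun i => x i ≠ 0).Nonempty := ⟨i, by simpa using hi⟩
      refine ⟨_, (mem_filter.mp (max'_mem _ hne)).2, fun i hi => ?_⟩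
      by_contra h0
      exact (not_le.mpr hi) (le_max' _ _ (by simpa using h0))
    obtain ⟨j, hjk, hj⟩ := hatt k
    have hs := h.short x j k hjk hk
    rw [hj] at hs
    have hterm : ∀ l, (∑ i, (x i : ℝ) * T i l) ^ 2 / M k ^ 2 ≤ (∑ i, (x i : ℝ) * A i l) ^ 2 := by
      intro l
      have hA' : ∑ i, (x i : ℝ) * A i l = (∑ i, (x i : ℝ) * T i l) / M l := by
        rw [sum_div]
        exact sum_congr rfl fun i _ => (mul_div_assoc _ _ _).symm
      rw [hA', div_pow]
      rcases le_or_gt l k with hl | hl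
      · have := hMpos l
        have := hmono hl
        gcongr
      -- Beyond `k` the vector has no coordinates: `T` is lower triangular and `x` stops at `k`.
      · have h0 : ∑ i, (x i : ℝ) * T i l = 0 := by
          refine sum_eq_zero fun i _ => ?_
          rcases le_or_gt i k with hi | hi
          · rw [h.lower i l (hi.trans_lt hl), mul_zero]
          · rw [hkmax i hi, Int.cast_zero, zero_mul]
        simp [h0]
    calc (1 : ℝ) ≤ (∑ l ∈ Ici j, (∑ i, (x i : ℝ) * T i l) ^ 2) / M k ^ 2 := by
          rwa [le_div_iff₀ (pow_pos (hMpos k) 2), one_mul]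
      _ ≤ ∑ l, (∑ i, (x i : ℝ) * T i l) ^ 2 / M k ^ 2 := by
          rw [← sum_div]
          exact div_le_div_of_nonneg_right (sum_le_sum_of_subset_of_nonneg (subset_univ _)
            fun _ _ _ => sq_nonneg _) (sq_nonneg _)
      _ ≤ _ := sum_le_sum fun l _ => hterm l

/-- The left-hand side is `(n + 3)! / (6 · 4ⁿ)`; Stirling's bound for `n!` leaves a polynomial
factor, written as a square because only its square root is used. -/
theorem prod_add_four_div_four_le (n : ℕ) (hn : 1 ≤ n) :
    ∏ i : Fin n, ((i : ℝ) + 4) / 4 ≤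
      (2 * ((n : ℝ) + 3) ^ 2) ^ 2 * ((n : ℝ) / (4 * Real.exp 1)) ^ n := by
  have hn' : (0 : ℝ) < n := by exact_mod_cast hn
  have h1 : ∀ m : ℕ, ∏ i : Fin m, ((i : ℝ) + 4) / 4 =
      (m.factorial : ℝ) * ((m + 1) * (m + 2) * (m + 3) / 6) / 4 ^ m := by
    intro m
    induction m with
    | zero => norm_num
    | succ m ih =>
      rw [Fin.prod_univ_castSucc]
      simp only [Fin.val_castSucc, Fin.val_last, ih, Nat.factorial_succ]
      push_cast
      field_simp
      ring
  have h2 : ((n : ℝ) + 1) * (n + 2) * (n + 3) / 6 ≤ (n + 3) ^ 3 := by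
    nlinarith [mul_pos hn' hn', mul_pos (mul_pos hn' hn') hn']
  have he : Real.exp 1 ≤ 4 := by linarith [Real.exp_one_lt_d9]
  rw [h1]
  calc (n.factorial : ℝ) * ((n + 1) * (n + 2) * (n + 3) / 6) / 4 ^ n
      ≤ (4 * (n + 3) * (n / Real.exp 1) ^ n) * (n + 3) ^ 3 / 4 ^ n := by
        gcongr
        refine (Nat.factorial_le_stirling n hn).trans ?_
        gcongr
        linarith
    _ = _ := by
        rw [div_pow, div_pow, mul_pow]
        field_simp
        ring

open Finset in
theorem IsHKZFactor.orthogonalityDefect_le {n : ℕ} (hn : 1 ≤ n) {b : Fin n → E}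
    {T : Matrix (Fin n) (Fin n) ℝ} (h : IsHKZFactor b T) :
    orthogonalityDefect b ≤
      2500 * ((n : ℝ) + 3) ^ 2 * √((n : ℝ) ^ 2 / (32 * Real.exp 1)) ^ n := by
  have hn' : (0 : ℝ) < n := by exact_mod_cast hn
  let M : Fin n → ℝ := fun k => (Iic k).sup' ⟨k, by simp⟩ fun j => T j j
  have hle : ∀ k, ∀ j ≤ k, T j j ≤ M k := fun k j hj =>
    le_sup' (fun j => T j j) (mem_Iic.mpr hj)
  have hprod := h.prod_le hn (M := M) (fun k l hkl => sup'_mono _ (Iic_subset_Iic.mpr hkl) _)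
    (fun i => hle i i le_rfl) fun k => by
      obtain ⟨j, hj, hjk⟩ := exists_mem_eq_sup' ⟨k, by simp⟩ (s := Iic k) fun j => T j j
      exact ⟨j, mem_Iic.mp hj, hjk.symm⟩
  have hMpos : ∀ i, 0 < M i := fun i => (h.diag_pos i).trans_le (hle i i le_rfl)
  have hT : 0 < ∏ i, T i i := prod_pos fun i _ => h.diag_pos i
  have hnorm : ∀ i, ‖b i‖ ≤ √(((i : ℝ) + 4) / 4) * M i := fun i => by
    rw [← sq_le_sq₀ (norm_nonneg _) (mul_nonneg (Real.sqrt_nonneg _) (hMpos i).le), mul_pow,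
      Real.sq_sqrt (by positivity)]
    exact h.norm_sq_le i (hle i)
  have hsqrt : ∏ i : Fin n, √(((i : ℝ) + 4) / 4) ≤
      2 * ((n : ℝ) + 3) ^ 2 * √((n : ℝ) / (4 * Real.exp 1)) ^ n := by
    refine (sq_le_sq₀ (prod_nonneg fun i _ => Real.sqrt_nonneg _) (by positivity)).mp ?_
    rw [← prod_pow, mul_pow, ← pow_mul, mul_comm n 2, pow_mul, Real.sq_sqrt (by positivity)]
    refine le_trans (le_of_eq ?_) (prod_add_four_div_four_le n hn)
    exact prod_congr rfl fun i _ => Real.sq_sqrt (by positivity)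
  rw [orthogonalityDefect, h.latticeDet_eq, div_le_iff₀ hT]
  calc ∏ i, ‖b i‖ ≤ ∏ i : Fin n, √(((i : ℝ) + 4) / 4) * M i :=
        prod_le_prod (fun i _ => norm_nonneg _) fun i _ => hnorm i
    _ = (∏ i : Fin n, √(((i : ℝ) + 4) / 4)) * ∏ i, M i := prod_mul_distrib
    _ ≤ (2 * ((n : ℝ) + 3) ^ 2 * √((n : ℝ) / (4 * Real.exp 1)) ^ n) *
        (10000 / 9 * √((n : ℝ) / 8) ^ n * ∏ i, T i i) :=
        mul_le_mul hsqrt hprod (prod_nonneg fun i _ => (hMpos i).le) (by positivity)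
    _ = 20000 / 9 * ((n : ℝ) + 3) ^ 2 * √((n : ℝ) ^ 2 / (32 * Real.exp 1)) ^ n * ∏ i, T i i := by
        have : √((n : ℝ) ^ 2 / (32 * Real.exp 1)) =
            √((n : ℝ) / (4 * Real.exp 1)) * √((n : ℝ) / 8) := by
          rw [← Real.sqrt_mul (by positivity)]
          congr 1
          field_simp
          norm_num
        rw [this, mul_pow]
        ring
    _ ≤ _ := by
        gcongr
        norm_num
end

/-! ### The asymptotic form -/

theorem isBigO_logb_log :
    (fun n : ℕ => Real.logb 2 (2500 * ((n : ℝ) + 3) ^ 2)) =O[Filter.atTop]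
      fun n : ℕ => Real.log (n : ℝ) := by
  refine Asymptotics.IsBigO.of_bound (18 / Real.log 2) ?_
  filter_upwards [Filter.eventually_ge_atTop 2] with n hn
  have hn' : (2 : ℝ) ≤ n := by exact_mod_cast hn
  have hl : 0 < Real.log 2 := Real.log_pos (by norm_num)
  have h1 : 0 ≤ Real.log (n : ℝ) := Real.log_nonneg (by linarith)
  have h2 : 0 ≤ Real.log (2500 * ((n : ℝ) + 3) ^ 2) := Real.log_nonneg (by nlinarith)
  have h3 : 2500 * ((n : ℝ) + 3) ^ 2 ≤ (n : ℝ) ^ 18 := by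
    have h4 : (n : ℝ) + 3 ≤ n ^ 3 := by
      nlinarith [mul_nonneg (sub_nonneg.mpr hn') (sub_nonneg.mpr hn')]
    -- `2500 ≤ 2 ^ 12`, so the constant costs the exponent `12`.
    have h5 : (2 : ℝ) ^ 12 ≤ (n : ℝ) ^ 12 := pow_le_pow_left₀ (by norm_num) hn' 12
    calc 2500 * ((n : ℝ) + 3) ^ 2 ≤ (n : ℝ) ^ 12 * (n ^ 3) ^ 2 := by gcongr; linarith
      _ = _ := by ring
  have h6 := Real.log_le_log (by positivity) h3
  rw [Real.log_pow] at h6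
  rw [Real.norm_of_nonneg (by rw [Real.logb]; positivity), Real.norm_of_nonneg h1, Real.logb,
    div_mul_eq_mul_div]
  gcongr
  exact_mod_cast h6

theorem mainTheorem2 :
    ∃ f : ℕ → ℝ, f =O[Filter.atTop] (fun n : ℕ => Real.log (n : ℝ)) ∧
      ∀ (n m : ℕ) (b : Fin n → EuclideanSpace ℝ (Fin m)), 1 ≤ n →
        LinearIndependent ℝ b → IsHKZReduced b →
          orthogonalityDefect b ≤
            (2 : ℝ) ^ ((n : ℝ) * Real.logb 2 (n : ℝ)
              - (5 / 2 + 1 / 2 * Real.logb 2 (Real.exp 1)) * (n : ℝ) + f n) := by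
  refine ⟨_, isBigO_logb_log, fun n m b hn hb hred => ?_⟩
  obtain ⟨T, hT⟩ := hred.exists_isHKZFactor hb
  refine (hT.orthogonalityDefect_le hn).trans (le_of_eq ?_)
  have hn' : (0 : ℝ) < n := by exact_mod_cast hn
  have he := Real.exp_pos 1
  have h32 : Real.logb 2 (32 : ℝ) = 5 := by
    rw [show (32 : ℝ) = 2 ^ (5 : ℕ) by norm_num, Real.logb_pow, Real.logb_self_eq_one (by norm_num)]
    norm_num
  symm
  rw [← Real.logb_eq_iff_rpow_eq (by norm_num) (by norm_num) (by positivity),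
    Real.logb_mul (by positivity) (by positivity), Real.logb_pow 2 (√_), Real.sqrt_eq_rpow,
    Real.logb_rpow_eq_mul_logb_of_pos (by positivity),
    Real.logb_div (by positivity) (by positivity),
    Real.logb_mul (x := 32) (by norm_num) he.ne', h32, Real.logb_pow]
  push_cast
  ring
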